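/- Let $\mathbb F_q$ be a finite field and $F/\mathbb F_q$ an algebraic function field of one variable with genus $g(F)$. For a place $P$ let $v_P$ be its normalized discrete valuation, let $\deg P$ be its residue degree over $\mathbb F_q$, and for $0\ne z\in F$ let $(z)_\infty=\sum_P\max(0,-v_P(z))\,P$; $\deg\sum n_PP=\sum n_P\deg P$. Let $m\ge 2$, $n\ge 1$ and suppose that $F/\mathbb F_q$ is $(m,n)$-friendly, that is, $(m-1)\mid g(F)$ and there are a rational place $Q$ and functions $z_1,z_2\in F$ such that $z_1$ has a simple zero or a simple pole at $Q$ (i.e. $v_Q(z_1)=\pm1$), $\deg((z_1)_\infty)=\frac{g(F)}{m-1}+1$, and $(z_2)_\infty=mQ$. Put $f_i=z_1^{i-1}$ $(1\le i\le m)$ and $g_j=z_2^{j-1}$ $(1\le j\le n)$. Then: 1. $v_Q(f_ig_j)=v_Q(z_1)(i-1)-m(j-1)$ for all $i,j$; in particular, if $z_1$ has a simple pole at $Q$, then $f_ig_j$ has pole order $i-1+m(j-1)$ at $Q$. These $mn$ values are pairwise distinct. 2. The $mn$ products $f_ig_j$ are linearly independent over $\mathbb F_q$, and $f_1,\dots,f_m$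 and $g_1,\dots,g_n$ form a polynomial AG code: both families are linearly independent and contained in $\mathcal L(\infty G)=\bigcup_{k}\mathcal L(kG)$ for some divisor $G$, and the $v_Q(f_ig_j)$ are pairwise distinct. 3. The recovery threshold of this code is exactly $R=g(F)+mn$. Here $R:=\deg((h)_\infty)+1$, where $h=fg=\sum_{i,j}A_iB_jf_ig_j$ is the product of $f=\sum_iA_if_i$ and $g=\sum_jB_jg_j$ for the row blocks $A_1,\dots,A_m$ of a matrix $A$ and the column blocks $B_1,\dots,B_n$ of a matrix $B$ over $\mathbb F_q$, and $(h)_\infty$ is the least common multiple (place by place maximum) of the divisors $(f_ig_j)_\infty$; for any fixed positive block sizes, this is the least effective divisor $D$ such that, for all $A$ and $B$, all entries of $h$ lie in $\mathcal L(D)$. Moreover, for any set of at least $g(F)+mn$ distinct rational places $P$ outside the support of $(h)_\infty$, the matrix $AB$ is determined by the responses $f(P)g(P)$ of the corresponding worker nodes. -/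

import Mathlib

noncomputable section

open scoped WithZero

namespace AGCode

/-- A place of `F/K`, given by its valuation ring: a discrete valuation ring with field of
fractions `F` that contains the constants `K`. -/
structure Place (K F : Type*) [Field K] [Field F] [Algebra K F] where
  /-- the valuation ring of the place -/
  ring : ValuationSubring F
  algebraMap_mem : ∀ c : K, algebraMap K F c ∈ ring
  isDVR : IsDiscreteValuationRing ring

namespace Place

instance instIsDVR {K F : Type*} [Field K] [Field F] [Algebra K F] (P : Place K F) :
    IsDiscreteValuationRing P.ring := P.isDVR

instance instAlgebra {K F : Type*} [Field K] [Field F] [Algebra K F] (P : Place K F) :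
    Algebra K P.ring :=
  ((algebraMap K F).codRestrict P.ring.toSubring P.algebraMap_mem).toAlgebra

/-- The normalized multiplicative valuation `z ↦ exp (- v_P z)` of the place. -/
def valuation {K F : Type*} [Field K] [Field F] [Algebra K F] (P : Place K F) :
    Valuation F ℤᵐ⁰ :=
  (IsDiscreteValuationRing.maximalIdeal P.ring).valuation F

/-- The normalized discrete valuation `v_P z` for `z ≠ 0` (with the dummy value `0` at `z = 0`). -/
def ord {K F : Type*} [Field K] [Field F] [Algebra K F] (P : Place K F) (z : F) : ℤ :=
  -WithZero.log (P.valuation z)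

/-- The degree `[O_P / P : K]` of the place. -/
def degree {K F : Type*} [Field K] [Field F] [Algebra K F] (P : Place K F) : ℕ :=
  Module.finrank K (IsLocalRing.ResidueField P.ring)

/-- A place is rational if its degree is one. -/
def IsRational {K F : Type*} [Field K] [Field F] [Algebra K F] (P : Place K F) : Prop :=
  P.degree = 1

/-- The order of the pole of `z` at `P`, that is `max (-v_P z) 0`. -/
def poleOrder {K F : Type*} [Field K] [Field F] [Algebra K F] (P : Place K F) (z : F) : ℕ :=
  (-P.ord z).toNat

open Classical in
/-- The value `z(P)` in `K` of a function `z` that is regular at the rational place `P`: the unique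
constant `c` such that `z - c` vanishes at `P` (and `0` if there is none). -/
def eval {K F : Type*} [Field K] [Field F] [Algebra K F] (P : Place K F) (z : F) : K :=
  if h : ∃ c : K, P.valuation (z - algebraMap K F c) < 1 then h.choose else 0

theorem valuation_algebraMap {K F : Type*} [Field K] [Field F] [Algebra K F] (P : Place K F)
    (c : K) : P.valuation (algebraMap K F c) ≤ 1 :=
  (IsDiscreteValuationRing.maximalIdeal P.ring).valuation_le_one
    (⟨algebraMap K F c, P.algebraMap_mem c⟩ : P.ring)

theorem nonneg_ord_add_iff {K F : Type*} [Field K] [Field F] [Algebra K F] (P : Place K F)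
    {z : F} (hz : z ≠ 0) (n : ℤ) :
    0 ≤ P.ord z + n ↔ P.valuation z ≤ WithZero.exp n := by
  have h : P.valuation z ≠ 0 := (Valuation.ne_zero_iff _).2 hz
  rw [← WithZero.log_le_iff_le_exp h, ord]
  constructor <;> intro h <;> linarith

end Place

/-- Divisors of `F/K`: finitely supported integer-valued functions on the places. -/
abbrev Divisor (K F : Type*) [Field K] [Field F] [Algebra K F] := Place K F →₀ ℤ

/-- The degree `∑ n_P deg P` of a formal sum `∑ n_P P` with finite support. -/
def degree {K F : Type*} [Field K] [Field F] [Algebra K F] (D : Place K F → ℤ) : ℤ :=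
  ∑ᶠ P : Place K F, D P * (P.degree : ℤ)

/-- The Riemann-Roch space `L(D)` of all `z` with `z = 0` or `(z) + D ≥ 0`. -/
def riemannRochSpace {K F : Type*} [Field K] [Field F] [Algebra K F] (D : Divisor K F) :
    Submodule K F where
  carrier := {z | z ≠ 0 → ∀ P : Place K F, 0 ≤ P.ord z + D P}
  zero_mem' := fun h => absurd rfl h
  add_mem' := by
    intro a b ha hb hab P
    rw [P.nonneg_ord_add_iff hab]
    refine (P.valuation.map_add a b).trans (max_le ?_ ?_)
    · by_cases h : a = 0
      · simp [h]
      · exact (P.nonneg_ord_add_iff h _).1 (ha h P)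
    · by_cases h : b = 0
      · simp [h]
      · exact (P.nonneg_ord_add_iff h _).1 (hb h P)
  smul_mem' := by
    intro c z hz hcz P
    have h : z ≠ 0 := fun h => hcz (by simp [h])
    rw [P.nonneg_ord_add_iff hcz, Algebra.smul_def, map_mul]
    calc P.valuation (algebraMap K F c) * P.valuation z
        ≤ 1 * P.valuation z := mul_le_mul_left (P.valuation_algebraMap c) _
      _ = P.valuation z := one_mul _
      _ ≤ _ := (P.nonneg_ord_add_iff h _).1 (hz h P)

/-- The genus of `F/K`: the maximum of `deg D - l(D) + 1` over all divisors `D`. -/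
def genus (K F : Type*) [Field K] [Field F] [Algebra K F] : ℤ :=
  sSup (Set.range fun D : Divisor K F =>
    degree D - (Module.finrank K (riemannRochSpace D) : ℤ) + 1)

/-- The pole divisor `(z)_∞` of a function `z`. -/
def poleDivisor {K F : Type*} [Field K] [Field F] [Algebra K F] (z : F) : Place K F → ℤ :=
  fun P => (P.poleOrder z : ℤ)

/-- The least common multiple (place by place maximum) of the pole divisors of all products
`f_i g_j`. -/
def productPoleDivisor {K F : Type*} [Field K] [Field F] [Algebra K F] {m n : ℕ}
    (f : Fin m → F) (g : Fin n → F) : Place K F → ℤ :=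
  fun P => ((Finset.univ.sup fun ij : Fin m × Fin n => P.poleOrder (f ij.1 * g ij.2) : ℕ) : ℤ)

/-- The matrix-coefficient polynomial `∑ A_i f_i`, where `A_1, …, A_m` are the blocks of rows
of `A`. -/
def leftPoly {K F : Type*} [Field K] [Field F] [Algebra K F] {m r s : ℕ} (f : Fin m → F)
    (A : Matrix (Fin m × Fin r) (Fin s) K) : Matrix (Fin r) (Fin s) F :=
  ∑ i, f i • (A.submatrix (fun a => (i, a)) id).map (algebraMap K F)

/-- The matrix-coefficient polynomial `∑ B_j g_j`, where `B_1, …, B_n` are the blocks of columns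
of `B`. -/
def rightPoly {K F : Type*} [Field K] [Field F] [Algebra K F] {n s t : ℕ} (g : Fin n → F)
    (B : Matrix (Fin s) (Fin n × Fin t) K) : Matrix (Fin s) (Fin t) F :=
  ∑ j, g j • (B.submatrix id (fun b => (j, b))).map (algebraMap K F)

/-- The response `f(P) g(P)` of the worker node attached to the rational place `P`, which has
received the two matrices `f(P) = (∑ A_i f_i)(P)` and `g(P) = (∑ B_j g_j)(P)` over `K`. -/
def response {K F : Type*} [Field K] [Field F] [Algebra K F] {m n r s t : ℕ}
    (f : Fin m → F) (g : Fin n → F) (A : Matrix (Fin m × Fin r) (Fin s) K)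
    (B : Matrix (Fin s) (Fin n × Fin t) K) (P : Place K F) : Matrix (Fin r) (Fin t) K :=
  (leftPoly f A).map P.eval * (rightPoly g B).map P.eval

/-- The functions `f_1, …, f_m` and `g_1, …, g_n` form a polynomial AG code with respect to the
place `Q`: both families are linearly independent, they lie in `L(∞G) = ⋃ L(kG)` for some
divisor `G`, and the valuations at `Q` of the products `f_i g_j` are pairwise distinct. -/
structure IsPolynomialAGCode {K F : Type*} [Field K] [Field F] [Algebra K F] {m n : ℕ}
    (Q : Place K F) (f : Fin m → F) (g : Fin n → F) : Prop where
  exists_divisor : ∃ G : Divisor K F, (∀ i, ∃ k : ℕ, f i ∈ riemannRochSpace (k • G)) ∧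
    ∀ j, ∃ k : ℕ, g j ∈ riemannRochSpace (k • G)
  left_linearIndependent : LinearIndependent K f
  right_linearIndependent : LinearIndependent K g
  ord_ne : ∀ i i' : Fin m, ∀ j j' : Fin n, (i, j) ≠ (i', j') →
    Q.ord (f i * g j) ≠ Q.ord (f i' * g j')

/-- The recovery threshold `deg (h)_∞ + 1`, where `h = (∑ A_i f_i) (∑ B_j g_j)` has indeterminate
data `A` and `B`, so that `(h)_∞` is the least common multiple of the pole divisors of the
functions `f_i g_j`. -/
def recoveryThreshold (K : Type*) {F : Type*} [Field K] [Field F] [Algebra K F] {m n : ℕ}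
    (f : Fin m → F) (g : Fin n → F) : ℤ :=
  degree (productPoleDivisor (K := K) f g) + 1

/-- The rational place `Q` and the functions `z₁`, `z₂` make `F/K` an `(m,n)`-friendly function
field. Both sign conventions for the valuation of `z₁` are admitted: `z₁` has at `Q` a simple zero
or a simple pole. -/
structure IsFriendly {K F : Type*} [Field K] [Field F] [Algebra K F] (m n : ℕ)
    (Q : Place K F) (z₁ z₂ : F) : Prop where
  two_le : 2 ≤ m
  one_le : 1 ≤ n
  isRational : Q.IsRational
  dvd_genus : (m : ℤ) - 1 ∣ genus K F
  ord_z₁ : Q.ord z₁ = 1 ∨ Q.ord z₁ = -1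
  degree_z₁ : degree (poleDivisor (K := K) z₁) = genus K F / ((m : ℤ) - 1) + 1
  poleDivisor_z₂ : poleDivisor z₂ = Finsupp.single Q (m : ℤ)

end AGCode

end

open scoped WithZero
open Polynomial

namespace AGCode

/-! ### Valuations trivial on the constants, and independence over `K[x]`. -/

section Basic

variable {K F : Type*} [Field K] [Field F] [Algebra K F]
  {Γ : Type*} [LinearOrderedCommGroupWithZero Γ]

/-! With indices starting at 0, `z₁ ^ i * z₂ ^ j` has order `± i - m j` at `Q`. Modulo `m` this
determines `i < m`, so the orders are distinct, and the strict triangle inequality makes the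
products linearly independent.

At every place the exponents `i` and `j` vary independently, so the largest pole order is reached
with each exponent either 0 or maximal. Hence `(h)_∞ = (m - 1)(z₁)_∞ + (n - 1)(z₂)_∞`, of degree `(m
- 1)(genus / (m - 1) + 1) + (n - 1) m = genus + m n - 1`. The genus enters only as this number; the
Riemann-Roch theorem plays no role.

For decoding, suppose two data pairs give the same responses. The difference of corresponding
entries of `h` lies in `L((h)_∞)` and vanishes at more than `deg (h)_∞` places, so it is zero, and
independence of the products recovers `AB`.

The bound on zeros (`card_zeros_le_degree`) is a dimension count. For a set `S` of zeros of `h ∈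
L(D)`, interpolate functions `u_P` with independent values on `S`. The functions `h ^ a * u_P`, `a ≤
k`, are independent and lie in `L(kD + C)` for a fixed `C`. So `(k + 1)|S| ≤ k deg D + deg C + 1`
for all `k`, and therefore `|S| ≤ deg D`. The dimension bound `l(D) ≤ deg D + 1` adds one place at a
time, starting from `L(-Q) = 0`; this start needs a pole for every transcendental function, supplied
by a valuation ring dominating `(x⁻¹)` in `K[x⁻¹]`. -/

theorem valuation_algebraMap_eq_one_of_forall_le_one (v : Valuation F Γ)
    (hv : ∀ c : K, v (algebraMap K F c) ≤ 1) {c : K} (hc : c ≠ 0) : v (algebraMap K F c) = 1 := by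
  refine le_antisymm (hv c) ?_
  have h := hv c⁻¹
  have h0 : 0 < v (algebraMap K F c) := by
    rw [zero_lt_iff, Valuation.ne_zero_iff]
    simpa using hc
  rw [map_inv₀, map_inv₀] at h
  exact (inv_le_one₀ h0).1 h

theorem valuation_aeval_le_one_of_forall_le_one (v : Valuation F Γ)
    (hv : ∀ c : K, v (algebraMap K F c) ≤ 1) {x : F} (hx : v x ≤ 1) (p : K[X]) :
    v (aeval x p) ≤ 1 := by
  rw [aeval_eq_sum_range]
  refine v.map_sum_le fun i _ => ?_
  rw [Algebra.smul_def, map_mul, map_pow]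
  exact mul_le_one' (hv _) (pow_le_one₀ zero_le hx)

/-- If `x` were algebraic, `x⁻¹` would be a polynomial in `x` and so have value at most 1. -/
theorem transcendental_of_valuation_lt_one (v : Valuation F Γ)
    (hv : ∀ c : K, v (algebraMap K F c) ≤ 1) {x : F} (h0 : x ≠ 0)
    (hx : v x < 1) : Transcendental K x := by
  intro hal
  have hinv : x⁻¹ ∈ Algebra.adjoin K {x} :=
    Subalgebra.inv_mem_of_algebraic (A := Algebra.adjoin K {x})
      (x := ⟨x, Algebra.self_mem_adjoin_singleton K x⟩) hal
  rw [Algebra.adjoin_singleton_eq_range_aeval] at hinv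
  obtain ⟨p, hp⟩ := hinv
  have h1 := valuation_aeval_le_one_of_forall_le_one v hv hx.le p
  have hp' : (aeval x) p = x⁻¹ := hp
  rw [hp', map_inv₀] at h1
  have h2 : 0 < v x := by rwa [zero_lt_iff, Valuation.ne_zero_iff]
  exact absurd ((inv_le_one₀ h2).1 h1) (not_le.2 hx)

/-- A linear combination of functions with pairwise distinct values has the value of one of the
functions that occur in it. -/
theorem exists_valuation_sum_smul_eq {ι : Type*} [Fintype ι] (v : Valuation F Γ)
    (hv : ∀ c : K, v (algebraMap K F c) ≤ 1) {u : ι → F}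
    (hu : Function.Injective fun i => v (u i)) {c : ι → K} (hc : c ≠ 0) :
    ∃ i, v (∑ j, c j • u j) = v (u i) := by
  classical
  obtain ⟨k, hk⟩ := Function.ne_iff.1 hc
  have hval : ∀ j, c j ≠ 0 → v (c j • u j) = v (u j) := fun j hj => by
    rw [Algebra.smul_def, map_mul, valuation_algebraMap_eq_one_of_forall_le_one v hv hj, one_mul]
  obtain ⟨i, hi, hmax⟩ := Finset.exists_max_image (Finset.univ.filter fun j => c j ≠ 0)
    (fun j => v (u j)) ⟨k, by simpa using hk⟩
  have hi : c i ≠ 0 := by simpa using hi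
  refine ⟨i, ?_⟩
  by_cases hsingle : ∀ j, j ≠ i → c j = 0
  · rw [Finset.sum_eq_single i (fun j _ hj => by rw [hsingle j hj, zero_smul]) (by simp),
      hval i hi]
  push Not at hsingle
  obtain ⟨j₀, hj₀, hcj₀⟩ := hsingle
  -- If the maximal value were 0, a second occurring term would also have value 0, against
  -- injectivity.
  have h0 : v (u i) ≠ 0 := by
    intro h0
    have := hmax j₀ (by simpa using hcj₀)
    rw [h0, le_zero_iff] at this
    exact hj₀ (hu (this.trans h0.symm))
  rw [← Finset.add_sum_erase _ _ (Finset.mem_univ i), v.map_add_eq_of_lt_left, hval i hi]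
  rw [hval i hi]
  refine v.map_sum_lt h0 fun j hj => ?_
  by_cases hcj : c j = 0
  · rwa [hcj, zero_smul, map_zero, zero_lt_iff]
  · rw [hval j hcj]
    exact lt_of_le_of_ne (hmax j (by simpa using hcj)) (fun h => Finset.ne_of_mem_erase hj (hu h))

/-- Independence over `K[x]` can be checked modulo `x`. -/
theorem eq_zero_of_sum_aeval_mul_eq_zero {ι : Type*} [Fintype ι] {x : F} (hx0 : x ≠ 0) {u : ι → F}
    (hind : ∀ (q : ι → K[X]) (c : ι → K),
      x * ∑ i, aeval x (q i) * u i + ∑ i, c i • u i = 0 → c = 0)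
    (p : ι → K[X]) (hp : ∑ i, aeval x (p i) * u i = 0) : p = 0 := by
  have key : ∀ k : ℕ, ∀ p : ι → K[X], ∑ i, aeval x (p i) * u i = 0 → ∀ i, (p i).coeff k = 0 := by
    intro k
    have hstep : ∀ p : ι → K[X], ∑ i, aeval x (p i) * u i = 0 →
        x * ∑ i, aeval x (p i).divX * u i + ∑ i, (p i).coeff 0 • u i = 0 := by
      intro p hp
      rw [← hp, Finset.mul_sum, ← Finset.sum_add_distrib]
      refine Finset.sum_congr rfl fun i _ => ?_
      have h := congrArg (aeval x) (p i).X_mul_divX_add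
      rw [map_add, map_mul, aeval_X, aeval_C] at h
      rw [← h, Algebra.smul_def]
      ring
    have hzero : ∀ p : ι → K[X], ∑ i, aeval x (p i) * u i = 0 → ∀ i, (p i).coeff 0 = 0 :=
      fun p hp => congr_fun (hind _ (fun i => (p i).coeff 0) (hstep p hp))
    induction k with
    | zero => exact hzero
    | succ k ih =>
      intro p hp i
      -- The constant coefficients vanish, so `x` can be cancelled: the same relation holds for the
      -- `divX`, whose coefficients are shifted by one.
      have h := hstep p hp
      simp only [hzero p hp, zero_smul, Finset.sum_const_zero, add_zero, mul_eq_zero, hx0,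
        false_or] at h
      rw [← coeff_divX]
      exact ih (fun i => (p i).divX) h i
  funext i
  ext k
  exact key k p hp i


/-! ### Places and weak approximation. -/

namespace Place

theorem ext_ring {P P' : Place K F} (h : P.ring = P'.ring) : P = P' := by
  cases P; cases P'; cases h; rfl

theorem valuation_le_one_iff (P : Place K F) {z : F} : P.valuation z ≤ 1 ↔ z ∈ P.ring := by
  constructor
  · intro h
    obtain ⟨a, rfl⟩ := IsDiscreteValuationRing.exists_lift_of_le_one h
    exact a.2
  · intro h
    exact (IsDiscreteValuationRing.maximalIdeal P.ring).valuation_le_one (⟨z, h⟩ : P.ring)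

theorem valuation_lt_one_iff (P : Place K F) (a : P.ring) :
    P.valuation (a : F) < 1 ↔ a ∈ IsLocalRing.maximalIdeal P.ring :=
  (IsDiscreteValuationRing.maximalIdeal P.ring).valuation_lt_one_iff_mem a

theorem exists_uniformizer (P : Place K F) : ∃ π : F, P.valuation π = WithZero.exp (-1 : ℤ) :=
  (IsDiscreteValuationRing.maximalIdeal P.ring).valuation_exists_uniformizer F

theorem valuation_eq_exp (P : Place K F) {z : F} (hz : z ≠ 0) :
    P.valuation z = WithZero.exp (-P.ord z) := by
  have h : P.valuation z ≠ 0 := (Valuation.ne_zero_iff _).2 hz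
  rw [ord, neg_neg, WithZero.exp_log h]

theorem ord_mul (P : Place K F) {x y : F} (hx : x ≠ 0) (hy : y ≠ 0) :
    P.ord (x * y) = P.ord x + P.ord y := by
  have h : P.valuation x ≠ 0 := (Valuation.ne_zero_iff _).2 hx
  have h' : P.valuation y ≠ 0 := (Valuation.ne_zero_iff _).2 hy
  rw [ord, map_mul, WithZero.log_mul h h', ord, ord]
  ring

theorem ord_pow (P : Place K F) (x : F) (k : ℕ) : P.ord (x ^ k) = k * P.ord x := by
  simp [ord]

theorem valuation_algebraMap_eq_one (P : Place K F) {c : K} (hc : c ≠ 0) :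
    P.valuation (algebraMap K F c) = 1 :=
  valuation_algebraMap_eq_one_of_forall_le_one P.valuation P.valuation_algebraMap hc

theorem valuation_aeval_le_one (P : Place K F) {x : F} (hx : P.valuation x ≤ 1) (p : K[X]) :
    P.valuation (aeval x p) ≤ 1 :=
  valuation_aeval_le_one_of_forall_le_one P.valuation P.valuation_algebraMap hx p

/-- A nonzero function that vanishes at some place is transcendental. -/
theorem transcendental_of_valuation_lt_one (P : Place K F) {x : F} (h0 : x ≠ 0)
    (hx : P.valuation x < 1) : Transcendental K x :=
  AGCode.transcendental_of_valuation_lt_one P.valuation P.valuation_algebraMap h0 hx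

theorem ring_ne_top (P : Place K F) : P.ring ≠ ⊤ := by
  intro h
  obtain ⟨π, hπ⟩ := P.exists_uniformizer
  have : P.valuation π⁻¹ ≤ 1 := by rw [valuation_le_one_iff, h]; trivial
  rw [map_inv₀, hπ, ← WithZero.exp_neg, neg_neg, ← WithZero.exp_zero, WithZero.exp_le_exp] at this
  omega

theorem exists_lt_pow (P : Place K F) {y : F} (hy : 1 < P.valuation y) (c : ℤᵐ⁰) :
    ∃ k : ℕ, ∀ l, k ≤ l → c < P.valuation y ^ l := by
  obtain ⟨k, hk⟩ := MulArchimedean.arch (c) hy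
  refine ⟨k + 1, fun l hl => hk.trans_lt ?_⟩
  exact pow_lt_pow_right₀ hy (by omega)

/-- A discrete valuation ring is maximal among proper subrings: the powers of any element outside it
outgrow every `y`, so a strictly larger ring is all of `F`. -/
theorem eq_of_ring_le {P P' : Place K F} (h : P.ring ≤ P'.ring) : P = P' := by
  by_contra hne
  obtain ⟨b, hb', hb⟩ : ∃ b, b ∈ P'.ring ∧ b ∉ P.ring := by
    by_contra! hcon
    exact hne (ext_ring (le_antisymm h hcon))
  refine P'.ring_ne_top (top_unique fun y _ => ?_)
  rw [← valuation_le_one_iff, not_le] at hb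
  obtain ⟨k, hk⟩ := P.exists_lt_pow hb (P.valuation y)
  have hk := hk k le_rfl
  have hb0 : b ^ k ≠ 0 := by
    intro h0
    rw [← map_pow, h0] at hk
    simp at hk
  have : y / b ^ k ∈ P.ring := by
    rw [← valuation_le_one_iff, map_div₀, map_pow]
    exact (div_le_one₀ (zero_le.trans_lt hk)).2 hk.le
  have := P'.ring.mul_mem _ _ (h this) (pow_mem hb' k)
  rwa [div_mul_cancel₀ _ hb0] at this

theorem exists_one_lt_lt_one {P P' : Place K F} (h : P ≠ P') :
    ∃ y, 1 < P.valuation y ∧ P'.valuation y < 1 := by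
  obtain ⟨a, ha, ha'⟩ : ∃ a, a ∈ P.ring ∧ a ∉ P'.ring := by
    by_contra! hcon
    exact h (eq_of_ring_le hcon)
  obtain ⟨b, hb', hb⟩ : ∃ b, b ∈ P'.ring ∧ b ∉ P.ring := by
    by_contra! hcon
    exact h.symm (eq_of_ring_le hcon)
  have ha0 : a ≠ 0 := by rintro rfl; exact ha' (zero_mem _)
  have h0 : 0 < P.valuation a := by rwa [zero_lt_iff, Valuation.ne_zero_iff]
  rw [← valuation_le_one_iff] at ha hb'
  rw [← valuation_le_one_iff, not_le] at ha' hb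
  refine ⟨b / a, ?_, ?_⟩
  · rw [map_div₀, one_lt_div₀ h0]
    exact ha.trans_lt hb
  · rw [map_div₀, div_lt_one₀ (zero_lt_one.trans ha')]
    exact hb'.trans_lt ha'

theorem valuation_one_add_of_lt (P : Place K F) {y : F} (h : P.valuation y < 1) :
    P.valuation (1 + y) = 1 := by
  rw [P.valuation.map_add_eq_of_lt_left (by simpa using h), map_one]

theorem valuation_one_add_of_gt (P : Place K F) {y : F} (h : 1 < P.valuation y) :
    P.valuation (1 + y) = P.valuation y :=
  P.valuation.map_add_eq_of_lt_right (by simpa using h)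

theorem exists_pow_mul_lt_one (P : Place K F) {y : F} (hy : P.valuation y < 1) (z : F) :
    ∃ k : ℕ, ∀ l, k ≤ l → P.valuation (y ^ l * z) < 1 := by
  by_cases h0 : y = 0
  · refine ⟨1, fun l hl => ?_⟩
    subst h0
    simp [zero_pow (by omega : l ≠ 0)]
  · have h0' : 0 < P.valuation y := by rwa [zero_lt_iff, Valuation.ne_zero_iff]
    obtain ⟨k, hk⟩ := P.exists_lt_pow (y := y⁻¹) (by rw [map_inv₀]; exact (one_lt_inv₀ h0').2 hy)
      (P.valuation z)
    refine ⟨k, fun l hl => ?_⟩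
    have := hk l hl
    rw [map_inv₀, inv_pow] at this
    rw [map_mul, map_pow, mul_comm, ← div_inv_eq_mul]
    exact (div_lt_one₀ (zero_le.trans_lt this)).2 this

/-- Induction on `S`. With `y` good for `S` and `z` separating `P` from the new place `P₁`, a high
power makes `y ^ k * z` small on `S`. If `y` has a pole at `P₁`, dividing by `1 + y ^ k` cancels it
at `P` and `P₁` without changing values on `S`. -/
theorem exists_one_lt_forall_lt_one (S : Finset (Place K F)) (P : Place K F) (hP : P ∉ S) :
    ∃ y, 1 < P.valuation y ∧ ∀ P' ∈ S, P'.valuation y < 1 := by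
  classical
  induction S using Finset.induction_on with
  | empty =>
    obtain ⟨π, hπ⟩ := P.exists_uniformizer
    refine ⟨π⁻¹, ?_, by simp⟩
    rw [map_inv₀, hπ, ← WithZero.exp_neg, ← WithZero.exp_zero, WithZero.exp_lt_exp]
    norm_num
  | insert P₁ S hP₁ ih =>
    simp only [Finset.mem_insert, not_or] at hP
    obtain ⟨y, hy, hyS⟩ := ih hP.2
    obtain ⟨z, hz, hz₁⟩ := exists_one_lt_lt_one hP.1
    have hk : ∃ k : ℕ, 1 ≤ k ∧ ∀ P' ∈ S, P'.valuation (y ^ k * z) < 1 := by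
      choose! k hk using fun (P' : Place K F) (h : P' ∈ S) => P'.exists_pow_mul_lt_one (hyS P' h) z
      refine ⟨S.sup k + 1, by omega, fun P' h => hk P' h _ ?_⟩
      exact (Finset.le_sup h).trans (Nat.le_succ _)
    obtain ⟨k, hk1, hk⟩ := hk
    have hyk : 1 < P.valuation (y ^ k) := by
      rw [map_pow]; exact one_lt_pow₀ hy (by omega)
    rcases le_or_gt (P₁.valuation y) 1 with h | h
    · refine ⟨y ^ k * z, ?_, ?_⟩
      · rw [map_mul]
        exact hyk.trans_le (le_mul_of_one_le_right' hz.le)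
      · simp only [Finset.mem_insert, forall_eq_or_imp]
        refine ⟨?_, hk⟩
        rw [map_mul, map_pow]
        exact (mul_le_of_le_one_left' (pow_le_one₀ zero_le h)).trans_lt hz₁
    · have hy₁ : 1 < P₁.valuation (y ^ k) := by
        rw [map_pow]; exact one_lt_pow₀ h (by omega)
      refine ⟨y ^ k * z / (1 + y ^ k), ?_, ?_⟩
      · rw [map_div₀, P.valuation_one_add_of_gt hyk, map_mul,
          mul_div_cancel_left₀ _ (zero_lt_one.trans hyk).ne']
        exact hz
      · simp only [Finset.mem_insert, forall_eq_or_imp]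
        constructor
        · rw [map_div₀, P₁.valuation_one_add_of_gt hy₁, map_mul,
            mul_div_cancel_left₀ _ (zero_lt_one.trans hy₁).ne']
          exact hz₁
        · intro P' h'
          rw [map_div₀, P'.valuation_one_add_of_lt, div_one]
          · exact hk P' h'
          · rw [map_pow]
            exact pow_lt_one₀ zero_le (hyS P' h') (by omega)

/-- Weak approximation, in the form needed for interpolation. -/
theorem exists_interpolation (S : Finset (Place K F)) (P : Place K F) (hP : P ∉ S) :
    ∃ u, P.valuation (u - 1) < 1 ∧ ∀ P' ∈ S, P'.valuation u < 1 := by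
  obtain ⟨y, hy, hyS⟩ := exists_one_lt_forall_lt_one S P hP
  have h1 := P.valuation_one_add_of_gt hy
  have h0 : 1 + y ≠ 0 := by
    intro h; rw [h, map_zero] at h1; rw [← h1] at hy; simp at hy
  refine ⟨y / (1 + y), ?_, fun P' h' => ?_⟩
  · have : y / (1 + y) - 1 = -(1 + y)⁻¹ := by field_simp; ring
    rw [this, Valuation.map_neg, map_inv₀, h1]
    exact inv_lt_one_of_one_lt₀ hy
  · rw [map_div₀, P'.valuation_one_add_of_lt (hyS P' h'), div_one]
    exact hyS P' h'

end Place

/-- Functions which are regular at `S` and whose values on `S` are linearly independent over the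
constants are linearly independent over `K[x]` for every `x ≠ 0` which vanishes on `S`. -/
theorem eq_zero_of_sum_aeval_mul_eq_zero_of_places {ι : Type*} [Fintype ι] (S : Set (Place K F))
    {x : F} (hx0 : x ≠ 0) (hx : ∀ P ∈ S, P.valuation x < 1) {u : ι → F}
    (hu : ∀ P ∈ S, ∀ i, P.valuation (u i) ≤ 1)
    (hind : ∀ c : ι → K, (∀ P ∈ S, P.valuation (∑ i, c i • u i) < 1) → c = 0)
    (p : ι → K[X]) (hp : ∑ i, aeval x (p i) * u i = 0) : p = 0 := by
  refine eq_zero_of_sum_aeval_mul_eq_zero hx0 (fun q c hqc => hind c fun P hP => ?_) p hp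
  rw [eq_neg_of_add_eq_zero_right hqc, Valuation.map_neg, map_mul]
  refine (mul_le_of_le_one_right' (P.valuation.map_sum_le fun i _ => ?_)).trans_lt (hx P hP)
  rw [map_mul]
  exact mul_le_one' (P.valuation_aeval_le_one (hx P hP).le _) (hu P hP i)

end Basic

end AGCode

namespace AGCode

/-! ### Discreteness of valuation rings and existence of poles. -/

section FunctionField

variable {K F : Type*} [Field K] [Field F] [Algebra K F]

theorem exists_aeval_eq_of_mem_adjoin {x z : F} (hz : z ∈ Algebra.adjoin K {x}) :
    ∃ p : K[X], aeval x p = z := by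
  rw [Algebra.adjoin_singleton_eq_range_aeval] at hz
  exact hz

open scoped IntermediateField.algebraAdjoinAdjoin in
/-- The degree of `F` over `K(x)` bounds the number of functions independent over `K[x]`. -/
theorem exists_card_le_of_aeval_independent [Algebra (RatFunc K) F] [IsScalarTower K (RatFunc K) F]
    [FunctionField K F] {x : F} (hx : Transcendental K x) :
    ∃ N : ℕ, ∀ (n : ℕ) (u : Fin n → F),
      (∀ p : Fin n → K[X], ∑ i, aeval x (p i) * u i = 0 → p = 0) → n ≤ N := by
  have := FunctionField.finiteDimensional_of_adjoin_transcendental hx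
  refine ⟨Module.finrank (IntermediateField.adjoin K {x}) F, fun n u hu => ?_⟩
  have hli : LinearIndependent (Algebra.adjoin K {x}) u := by
    rw [Fintype.linearIndependent_iff]
    intro c hc
    have hex : ∀ i, ∃ p : K[X], aeval x p = (c i : F) := by
      intro i
      exact exists_aeval_eq_of_mem_adjoin (c i).2
    choose p hp using hex
    have h0 : p = 0 := by
      refine hu p ?_
      rw [← hc]
      refine Finset.sum_congr rfl fun i _ => ?_
      rw [hp]; rfl
    intro i
    ext
    rw [← hp i, h0]
    simp
  -- Clearing denominators passes from `K[x]` to `K(x)`, over which `F` has finite dimension.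
  have hli' : LinearIndependent (IntermediateField.adjoin K {x}) u :=
    (LinearIndependent.iff_fractionRing (Algebra.adjoin K {x}) _).1 hli
  simpa using hli'.fintype_card_le_finrank

/-- A proper valuation ring of a function field with at most finitely many values above each
nonzero value is a discrete valuation ring. -/
theorem isDiscreteValuationRing_of_bounded (A : ValuationSubring F) (hA : A ≠ ⊤)
    (hbd : ∀ x : F, x ≠ 0 → ∃ N : ℕ, ∀ (n : ℕ) (u : Fin n → F), (∀ i, A.valuation (u i) ≤ 1) →
      (∀ i, A.valuation x < A.valuation (u i)) → StrictAnti (fun i => A.valuation (u i)) → n ≤ N) :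
    IsDiscreteValuationRing A := by
  have hnf : ¬ IsField A := by
    intro h
    apply hA
    refine top_unique fun y _ => ?_
    by_contra hy
    have hy' := (A.mem_or_inv_mem y).resolve_left hy
    have h0 : (⟨y⁻¹, hy'⟩ : A) ≠ 0 := by
      intro h
      have : y⁻¹ = 0 := congrArg Subtype.val h
      rw [inv_eq_zero] at this
      exact hy (this ▸ zero_mem _)
    obtain ⟨b, hb⟩ := h.mul_inv_cancel h0
    have hb' : y⁻¹ * (b : F) = 1 := congrArg Subtype.val hb
    have : y = b := by
      have h1 : y⁻¹ ≠ 0 := left_ne_zero_of_mul_eq_one hb'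
      rw [inv_mul_eq_one₀ (by simpa using h1)] at hb'
      exact hb'
    exact hy (this ▸ b.2)
  have hnoeth : IsNoetherianRing A := by
    rw [isNoetherianRing_iff, ← monotone_stabilizes_iff_noetherian]
    intro f
    by_contra! hcon
    have hstep : ∀ n, ∃ m, n < m ∧ ∃ a ∈ f m, a ∉ f n := by
      intro n
      obtain ⟨m, hm, hne⟩ := hcon n
      have hlt : f n < f m := lt_of_le_of_ne (f.mono hm) hne
      obtain ⟨a, ha, ha'⟩ := Set.exists_of_ssubset hlt
      refine ⟨m, lt_of_le_of_ne hm ?_, a, ha, ha'⟩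
      rintro rfl
      exact hne rfl
    choose m hm a ha ha' using hstep
    let s : ℕ → ℕ := fun k => m^[k] 0
    have hs : ∀ k, s (k + 1) = m (s k) := fun k => Function.iterate_succ_apply' m k 0
    have hval : ∀ k, ∀ b : A, b ∈ f (s k) → A.valuation (b : F) < A.valuation (a (s k) : F) := by
      intro k b hb
      by_contra! hle
      rw [A.valuation_le_iff] at hle
      obtain ⟨c, hc⟩ := hle
      apply ha' (s k)
      have : a (s k) = c * b := Subtype.ext hc.symm
      rw [this]
      exact Ideal.mul_mem_left _ _ hb
    have hmono : StrictMono fun k => A.valuation (a (s k) : F) := by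
      refine strictMono_nat_of_lt_succ fun k => hval (k + 1) _ ?_
      rw [hs]
      exact ha (s k)
    obtain ⟨N, hN⟩ := hbd (a (s 0)) (by
      intro h0
      have : a (s 0) = 0 := Subtype.ext h0
      exact ha' (s 0) (this ▸ zero_mem _))
    -- A non-stabilizing chain of ideals gives strictly increasing values. The index is reversed to
    -- make them decreasing, and shifted by 1 to stay strictly above the value of `a (s 0)`.
    have := hN (N + 1) (fun i => a (s (i.rev + 1))) (fun i => A.valuation_le_one _)
      (fun i => hmono (Nat.succ_pos _)) (by
        intro i j hij
        apply hmono
        have := Fin.rev_lt_rev.2 hij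
        have : (j.rev : ℕ) < i.rev := this
        omega)
    omega
  have hpir : IsPrincipalIdealRing A := inferInstance
  exact { not_a_field' := fun h => hnf (IsLocalRing.isField_iff_maximalIdeal_eq.2 h) }

variable [Algebra (RatFunc K) F] [IsScalarTower K (RatFunc K) F] [FunctionField K F]

/-- Every transcendental function has a pole. -/
theorem Place.exists_one_lt_valuation {x : F} (hx : Transcendental K x) :
    ∃ P : Place K F, 1 < P.valuation x := by
  have hx0 : x ≠ 0 := by rintro rfl; exact hx isAlgebraic_zero
  let R : Subalgebra K F := Algebra.adjoin K {x⁻¹}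
  let y : R := ⟨x⁻¹, Algebra.self_mem_adjoin_singleton K _⟩
  -- Otherwise `x = p(x⁻¹)`, and `X * p - 1`, whose constant coefficient is `-1`, would annihilate
  -- `x⁻¹`.
  have hI : Ideal.span {y} ≠ ⊤ := by
    rw [Ne, Ideal.span_singleton_eq_top]
    intro hu
    obtain ⟨b, hb⟩ := hu.exists_right_inv
    have hb' : x⁻¹ * (b : F) = 1 := congrArg Subtype.val hb
    have hbx : (b : F) = x := by
      rwa [inv_mul_eq_one₀ hx0, eq_comm] at hb'
    obtain ⟨p, hp⟩ := exists_aeval_eq_of_mem_adjoin b.2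
    rw [hbx] at hp
    have ht : Transcendental K x⁻¹ := fun h => hx (by simpa using h.inv)
    have h0 : aeval x⁻¹ (X * p - 1) = 0 := by
      rw [map_sub, map_mul, aeval_X, hp, map_one, inv_mul_cancel₀ hx0, sub_self]
    have h1 : X * p - 1 = 0 := by
      by_contra hne
      exact ht ⟨_, hne, h0⟩
    have := congrArg (Polynomial.eval 0) h1
    simp at this
  obtain ⟨A, hRA, hIA⟩ := Ideal.image_subset_nonunits_valuationSubring
    (A := R.toSubring) (Ideal.span {y}) hI
  have hKA : ∀ c : K, algebraMap K F c ∈ A := fun c => hRA (R.algebraMap_mem c)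
  have hyA : A.valuation x⁻¹ < 1 :=
    hIA ⟨y, Ideal.mem_span_singleton_self y, rfl⟩
  have hxA : x ∉ A := by
    intro h
    rw [← A.valuation_le_one_iff] at h
    rw [map_inv₀] at hyA
    have h0 : 0 < A.valuation x := by rwa [zero_lt_iff, Valuation.ne_zero_iff]
    exact absurd ((inv_lt_one₀ h0).1 hyA) (not_lt.2 h)
  have hK : ∀ c : K, A.valuation (algebraMap K F c) ≤ 1 :=
    fun c => (A.valuation_le_one_iff _).2 (hKA c)
  have hdvr : IsDiscreteValuationRing A := by
    refine isDiscreteValuationRing_of_bounded A (fun h => hxA (h ▸ trivial)) fun z hz => ?_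
    by_cases hz1 : A.valuation z < 1
    -- Functions with distinct values above that of `z` are independent over `K[z]`: a nontrivial
    -- constant combination keeps the value of some `u i`, too large to be a multiple of `z`. So
    -- their number is bounded by the degree of `F` over `K(z)`.
    · obtain ⟨N, hN⟩ := exists_card_le_of_aeval_independent
        (AGCode.transcendental_of_valuation_lt_one A.valuation hK hz hz1)
      refine ⟨N, fun n u hu1 huz hanti => hN n u fun p hp => ?_⟩
      refine eq_zero_of_sum_aeval_mul_eq_zero hz (fun q c hqc => ?_) p hp
      by_contra hc
      obtain ⟨i, hi⟩ := exists_valuation_sum_smul_eq A.valuation hK hanti.injective hc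
      have hle : A.valuation (∑ j, c j • u j) ≤ A.valuation z := by
        rw [eq_neg_of_add_eq_zero_right hqc, Valuation.map_neg, map_mul]
        refine mul_le_of_le_one_right' (A.valuation.map_sum_le fun i _ => ?_)
        rw [map_mul]
        exact mul_le_one' (valuation_aeval_le_one_of_forall_le_one A.valuation hK hz1.le _) (hu1 i)
      exact absurd (huz i) (not_lt.2 (hi ▸ hle))
    · refine ⟨0, fun n u hu1 huz _ => ?_⟩
      by_contra hn
      exact hz1 ((huz ⟨0, by omega⟩).trans_le (hu1 _))
  refine ⟨⟨A, hKA, hdvr⟩, ?_⟩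
  rw [← not_le, Place.valuation_le_one_iff]
  exact hxA

end FunctionField

end AGCode

namespace AGCode

/-! ### Riemann-Roch spaces and the number of zeros. -/

section Divisors

variable {K F : Type*} [Field K] [Field F] [Algebra K F]

theorem mem_riemannRochSpace_iff {D : Divisor K F} {z : F} :
    z ∈ riemannRochSpace D ↔ ∀ P : Place K F, P.valuation z ≤ WithZero.exp (D P) := by
  by_cases hz : z = 0
  · subst hz
    simp [(riemannRochSpace D).zero_mem]
  · exact ⟨fun h P => (P.nonneg_ord_add_iff hz _).1 (h hz P),
      fun h _ P => (P.nonneg_ord_add_iff hz _).2 (h P)⟩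

theorem riemannRochSpace_mono {D E : Divisor K F} (h : D ≤ E) :
    riemannRochSpace D ≤ riemannRochSpace E := fun _ hz hz0 P =>
  (hz hz0 P).trans (by have := h P; omega)

theorem mul_mem_riemannRochSpace {D E : Divisor K F} {x y : F} (hx : x ∈ riemannRochSpace D)
    (hy : y ∈ riemannRochSpace E) : x * y ∈ riemannRochSpace (D + E) := by
  rw [mem_riemannRochSpace_iff] at *
  intro P
  rw [map_mul, Finsupp.add_apply, WithZero.exp_add]
  exact mul_le_mul' (hx P) (hy P)

theorem pow_mem_riemannRochSpace {D : Divisor K F} {x : F} (hx : x ∈ riemannRochSpace D) (k : ℕ) :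
    x ^ k ∈ riemannRochSpace (k • D) := by
  induction k with
  | zero =>
    rw [mem_riemannRochSpace_iff]
    simp
  | succ k ih =>
    rw [pow_succ, add_smul, one_smul]
    exact mul_mem_riemannRochSpace ih hx

theorem degree_eq_sum (D : Divisor K F) : degree D = D.sum fun P n => n * (P.degree : ℤ) := by
  rw [degree, Finsupp.sum]
  refine finsum_eq_sum_of_support_subset _ fun P hP => ?_
  simp only [Finset.mem_coe, Finsupp.mem_support_iff]
  exact left_ne_zero_of_mul hP

theorem degree_add (D E : Divisor K F) : degree (D + E : Divisor K F) = degree D + degree E := by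
  simp only [degree_eq_sum]
  exact Finsupp.sum_add_index' (by simp) (by intros; ring)

theorem degree_single (P : Place K F) (n : ℤ) :
    degree (Finsupp.single P n : Divisor K F) = n * P.degree := by
  rw [degree_eq_sum, Finsupp.sum_single_index (by simp)]

theorem degree_nsmul (k : ℕ) (D : Divisor K F) : degree (k • D : Divisor K F) = k * degree D := by
  induction k with
  | zero => simp [degree]
  | succ k ih => rw [add_smul, one_smul, degree_add, ih]; push_cast; ring

theorem degree_nonneg {D : Divisor K F} (hD : 0 ≤ D) : 0 ≤ degree D := by
  rw [degree_eq_sum]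
  exact Finset.sum_nonneg fun P _ => mul_nonneg (hD P) (Nat.cast_nonneg _)

theorem Place.residue_eq_zero_iff (P : Place K F) (a : P.ring) :
    IsLocalRing.residue P.ring a = 0 ↔ P.valuation (a : F) < 1 := by
  rw [IsLocalRing.residue_eq_zero_iff, valuation_lt_one_iff]

theorem Place.coe_smul (P : Place K F) (c : K) (a : P.ring) :
    ((c • a : P.ring) : F) = c • (a : F) := by
  rw [Algebra.smul_def, Algebra.smul_def]
  rfl

theorem Place.residue_smul (P : Place K F) (c : K) (a : P.ring) :
    IsLocalRing.residue P.ring (c • a) = c • IsLocalRing.residue P.ring a := by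
  rw [Algebra.smul_def, Algebra.smul_def, map_mul]
  rfl

theorem lt_exp_add_one_iff {a : ℤᵐ⁰} {n : ℤ} : a < WithZero.exp (n + 1) ↔ a ≤ WithZero.exp n := by
  by_cases h : a = 0
  · simp [h]
  · rw [← WithZero.exp_log h, WithZero.exp_lt_exp, WithZero.exp_le_exp]
    omega

/-- The coefficient of the leading term at `P` of a function in `L(D + P)`. -/
theorem exists_leadingCoeff (D : Divisor K F) (P : Place K F) :
    ∃ φ : riemannRochSpace (D + Finsupp.single P 1) →ₗ[K] IsLocalRing.ResidueField P.ring,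
      ∀ z, φ z = 0 ↔ (z : F) ∈ riemannRochSpace D := by
  obtain ⟨π, hπ⟩ := P.exists_uniformizer
  -- Multiplication by `w` turns the largest allowed pole at `P` into a unit, so the residue of `z *
  -- w` reads off the leading coefficient.
  set w : F := π ^ (D P + 1)
  have hw : P.valuation w = WithZero.exp (-(D P + 1)) := by
    rw [map_zpow₀, hπ, ← WithZero.exp_zsmul, smul_eq_mul, mul_neg_one]
  have hmem : ∀ z : riemannRochSpace (D + Finsupp.single P 1), (z : F) * w ∈ P.ring := by
    intro z
    have hz := mem_riemannRochSpace_iff.1 z.2 P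
    rw [← P.valuation_le_one_iff, map_mul, hw, WithZero.exp_neg, ← div_eq_mul_inv,
      div_le_one₀ WithZero.exp_pos]
    simpa using hz
  refine ⟨{ toFun := fun z => IsLocalRing.residue P.ring ⟨z * w, hmem z⟩
            map_add' := fun x y => ?_
            map_smul' := fun c x => ?_ }, fun z => ?_⟩
  · rw [← map_add]
    congr 1
    ext
    exact add_mul _ _ _
  · rw [RingHom.id_apply, ← P.residue_smul]
    congr 1
    ext
    rw [P.coe_smul]
    exact smul_mul_assoc _ _ _
  · simp only [LinearMap.coe_mk, AddHom.coe_mk]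
    rw [P.residue_eq_zero_iff]
    simp only
    rw [map_mul, hw, WithZero.exp_neg, ← div_eq_mul_inv,
      div_lt_one₀ WithZero.exp_pos, lt_exp_add_one_iff, mem_riemannRochSpace_iff]
    refine ⟨fun h P' => ?_, fun h => h P⟩
    by_cases hP : P' = P
    · rw [hP]; exact h
    · have := mem_riemannRochSpace_iff.1 z.2 P'
      rwa [Finsupp.add_apply, Finsupp.single_eq_of_ne hP, add_zero] at this

/-- Interpolation gives one function per place, with value 1 there and 0 at the rest of `S`. -/
theorem exists_independent_on (S : Finset (Place K F)) : ∃ u : S → F,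
    (∀ P : S, ∀ i, P.1.valuation (u i) ≤ 1) ∧
    ∀ c : S → K, (∀ P : S, P.1.valuation (∑ i, c i • u i) < 1) → c = 0 := by
  classical
  choose u hu1 hu0 using fun P : S => Place.exists_interpolation (S.erase P.1) P.1 (by simp)
  have hne : ∀ P i : S, P ≠ i → P.1.valuation (u i) < 1 := fun P i h =>
    hu0 i P.1 (Finset.mem_erase.2 ⟨fun h' => h (Subtype.ext h'), P.2⟩)
  have heq : ∀ P : S, P.1.valuation (u P) = 1 := fun P => by
    have := P.1.valuation_one_add_of_lt (hu1 P)
    rwa [add_sub_cancel] at this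
  refine ⟨u, fun P i => ?_, fun c hc => ?_⟩
  · by_cases h : P = i
    · rw [← h, heq]
    · exact (hne P i h).le
  · funext P
    by_contra hcP
    have hcP : c P ≠ 0 := hcP
    have hval : P.1.valuation (c P • u P) = 1 := by
      rw [Algebra.smul_def, map_mul, P.1.valuation_algebraMap_eq_one hcP, heq, one_mul]
    have h := hc P
    rw [← Finset.add_sum_erase _ _ (Finset.mem_univ P),
      P.1.valuation.map_add_eq_of_lt_left, hval] at h
    · exact lt_irrefl _ h
    · rw [hval]
      refine P.1.valuation.map_sum_lt one_ne_zero fun i hi => ?_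
      rw [Algebra.smul_def, map_mul]
      exact (mul_le_of_le_one_left' (P.1.valuation_algebraMap _)).trans_lt
        (hne P i (Finset.ne_of_mem_erase hi).symm)

theorem Place.poleOrder_eq_zero_iff (P : Place K F) {z : F} :
    P.poleOrder z = 0 ↔ P.valuation z ≤ 1 := by
  by_cases hz : z = 0
  · simp [hz, poleOrder, ord]
  · rw [poleOrder, Int.toNat_eq_zero, P.valuation_eq_exp hz, ← WithZero.exp_zero,
      WithZero.exp_le_exp]

theorem Place.valuation_le_exp_poleOrder (P : Place K F) (z : F) :
    P.valuation z ≤ WithZero.exp (P.poleOrder z : ℤ) := by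
  by_cases hz : z = 0
  · simp [hz]
  · rw [P.valuation_eq_exp hz, WithZero.exp_le_exp, poleOrder]
    exact Int.self_le_toNat _

variable [Algebra (RatFunc K) F] [IsScalarTower K (RatFunc K) F] [FunctionField K F]

/-- Any `N + 1` zeros of `x` yield, by interpolation, `N + 1` functions independent over `K[x]`. -/
theorem finite_zeros {x : F} (hx0 : x ≠ 0) : {P : Place K F | P.valuation x < 1}.Finite := by
  by_contra hinf
  obtain ⟨P, hP⟩ := Set.Infinite.nonempty hinf
  obtain ⟨N, hN⟩ := exists_card_le_of_aeval_independent
    (P.transcendental_of_valuation_lt_one hx0 hP)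
  obtain ⟨S, hS, hcard⟩ := Set.Infinite.exists_subset_card_eq hinf (N + 1)
  obtain ⟨u, hu, hind⟩ := exists_independent_on S
  let e : Fin (N + 1) ≃ S := (Fintype.equivFinOfCardEq (by simpa using hcard)).symm
  have := hN (N + 1) (u ∘ e) fun p hp =>
    eq_zero_of_sum_aeval_mul_eq_zero_of_places (S : Set (Place K F)) hx0 (fun P h => hS h)
      (fun P h i => hu ⟨P, h⟩ _) (fun c hc => by
        have h := hind (c ∘ e.symm) fun P => by
          rw [← e.sum_comp]
          simpa using hc P.1 P.2
        funext i
        simpa using congr_fun h (e i)) p hp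
  omega

theorem finite_poles (x : F) : {P : Place K F | 1 < P.valuation x}.Finite := by
  by_cases hx : x = 0
  · simp [hx]
  · refine (finite_zeros (inv_ne_zero hx)).subset fun P hP => ?_
    rw [Set.mem_ofPred_eq, map_inv₀]
    exact inv_lt_one_of_one_lt₀ hP

/-- Lifts of independent residues are independent over `K[x]` for a uniformizer `x`, which bounds
their number. -/
instance finite_residueField (P : Place K F) :
    Module.Finite K (IsLocalRing.ResidueField P.ring) := by
  obtain ⟨x, hx⟩ := P.exists_uniformizer
  have hx0 : x ≠ 0 := by
    rintro rfl
    rw [map_zero] at hx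
    exact WithZero.exp_ne_zero hx.symm
  have hx1 : P.valuation x < 1 := by
    rw [hx, ← WithZero.exp_zero, WithZero.exp_lt_exp]; norm_num
  obtain ⟨N, hN⟩ := exists_card_le_of_aeval_independent
    (P.transcendental_of_valuation_lt_one hx0 hx1)
  have hrank : Module.rank K (IsLocalRing.ResidueField P.ring) ≤ N := by
    refine rank_le fun s hs => ?_
    let e : Fin s.card ≃ s := s.equivFin.symm
    choose u hu using fun i =>
      IsLocalRing.residue_surjective (R := P.ring) (e i : IsLocalRing.ResidueField P.ring)
    refine hN s.card (fun i => (u i : F)) fun p hp =>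
      eq_zero_of_sum_aeval_mul_eq_zero_of_places {P} hx0 (by simpa using hx1)
        (fun P' h i => by
          rw [Set.mem_singleton_iff.1 h, P.valuation_le_one_iff]
          exact (u i).2) (fun c hc => ?_) p hp
    have h := hc P rfl
    have hcoe : ∑ i, c i • (u i : F) = ((∑ i, c i • u i : P.ring) : F) := by
      rw [AddSubmonoidClass.coe_finsetSum]
      exact Finset.sum_congr rfl fun i _ => (P.coe_smul _ _).symm
    rw [hcoe, ← P.residue_eq_zero_iff, map_sum] at h
    simp only [P.residue_smul, hu] at h
    have hli : LinearIndependent K fun i => (e i : IsLocalRing.ResidueField P.ring) :=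
      hs.comp e e.injective
    exact funext (Fintype.linearIndependent_iff.1 hli c h)
  exact Module.rank_lt_aleph0_iff.1 (hrank.trans_lt (Cardinal.natCast_lt_aleph0))

/-- The leading coefficient map has kernel `L(D)` and takes values in a space of dimension `deg P`.
-/
theorem finite_riemannRochSpace_add_single {D : Divisor K F} (P : Place K F)
    [Module.Finite K (riemannRochSpace D)] :
    Module.Finite K (riemannRochSpace (D + Finsupp.single P 1)) ∧
    Module.finrank K (riemannRochSpace (D + Finsupp.single P 1)) ≤
      Module.finrank K (riemannRochSpace D) + P.degree := by
  obtain ⟨φ, hφ⟩ := exists_leadingCoeff D P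
  have hle : riemannRochSpace D ≤ riemannRochSpace (D + Finsupp.single P 1) :=
    riemannRochSpace_mono (le_add_of_nonneg_right (by simp))
  have hker : LinearMap.ker φ =
      (riemannRochSpace D).comap (riemannRochSpace (D + Finsupp.single P 1)).subtype := by
    ext z
    simpa using hφ z
  let e : LinearMap.ker φ ≃ₗ[K] riemannRochSpace D :=
    (LinearEquiv.ofEq _ _ hker).trans (Submodule.comapSubtypeEquivOfLe hle)
  have hfk : Module.Finite K (LinearMap.ker φ) := Module.Finite.equiv e.symm
  have hfin : Module.Finite K (riemannRochSpace (D + Finsupp.single P 1)) := by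
    have : Module.Finite K (_ ⧸ LinearMap.ker φ) := Module.Finite.equiv φ.quotKerEquivRange.symm
    exact Module.Finite.of_submodule_quotient (LinearMap.ker φ)
  refine ⟨hfin, ?_⟩
  rw [← φ.finrank_range_add_finrank_ker, e.finrank_eq, add_comm]
  exact Nat.add_le_add_left (LinearMap.range φ).finrank_le _

/-- A function without poles that vanishes at a place is zero. -/
theorem riemannRochSpace_neg_single (Q : Place K F) :
    riemannRochSpace (-Finsupp.single Q 1 : Divisor K F) = ⊥ := by
  rw [eq_bot_iff]
  intro z hz
  rw [Submodule.mem_bot]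
  by_contra hz0
  rw [mem_riemannRochSpace_iff] at hz
  have hQ : Q.valuation z < 1 := by
    rw [← WithZero.exp_zero, ← neg_add_cancel (1 : ℤ), lt_exp_add_one_iff]
    simpa using hz Q
  obtain ⟨P, hP⟩ := Place.exists_one_lt_valuation (Q.transcendental_of_valuation_lt_one hz0 hQ)
  refine absurd ((hz P).trans ?_) (not_le.2 hP)
  rw [← WithZero.exp_zero, WithZero.exp_le_exp, Finsupp.neg_apply, neg_nonpos]
  exact (Finsupp.single_nonneg.2 zero_le_one) P

/-- The elementary upper bound for the dimension of a Riemann-Roch space. -/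
theorem finrank_riemannRochSpace_le {Q : Place K F} (hQ : Q.IsRational) {D : Divisor K F}
    (hD : 0 ≤ D) : Module.Finite K (riemannRochSpace D) ∧
      (Module.finrank K (riemannRochSpace D) : ℤ) ≤ degree D + 1 := by
  induction D using Finsupp.induction with
  | zero =>
    -- `L(0)` is reached from `L(-Q) = 0` by adding `Q`; since `deg Q = 1`, its dimension is at most
    -- 1.
    have h0 := riemannRochSpace_neg_single Q
    have : Module.Finite K (riemannRochSpace (-Finsupp.single Q 1 : Divisor K F)) := by
      rw [h0]; infer_instance
    obtain ⟨h1, h2⟩ := finite_riemannRochSpace_add_single (D := -Finsupp.single Q 1) Q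
    rw [neg_add_cancel] at h1 h2
    refine ⟨h1, ?_⟩
    rw [h0, finrank_bot, zero_add, hQ] at h2
    have : degree ⇑(0 : Divisor K F) = 0 := by simp [degree]
    rw [this]
    exact_mod_cast h2
  | single_add P b D hP hb ih =>
    have hb0 : 0 ≤ b := by
      have := hD P
      simpa [Finsupp.notMem_support_iff.1 hP] using this
    have hD0 : 0 ≤ D := by
      intro P'
      by_cases h : P' = P
      · rw [h, Finsupp.notMem_support_iff.1 hP]; rfl
      · have := hD P'
        rwa [Finsupp.add_apply, Finsupp.single_eq_of_ne h, zero_add] at this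
    lift b to ℕ using hb0
    clear hb hD
    induction b with
    | zero => rw [Nat.cast_zero, Finsupp.single_zero, zero_add]; exact ih hD0
    | succ b ihb =>
      have heq : (Finsupp.single P ((b + 1 : ℕ) : ℤ) + D : Divisor K F) =
          Finsupp.single P (b : ℤ) + D + Finsupp.single P 1 := by
        push_cast
        rw [Finsupp.single_add]
        abel
      rw [heq]
      obtain ⟨h1, h2⟩ := ihb
      obtain ⟨h3, h4⟩ := finite_riemannRochSpace_add_single (D := Finsupp.single P (b : ℤ) + D) P
      refine ⟨h3, ?_⟩
      rw [degree_add _ (Finsupp.single P 1), degree_single, one_mul]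
      have : (Module.finrank K (riemannRochSpace
        (Finsupp.single P (b : ℤ) + D + Finsupp.single P 1)) : ℤ) ≤
        Module.finrank K (riemannRochSpace (Finsupp.single P (b : ℤ) + D)) + P.degree := by
          exact_mod_cast h4
      linarith

theorem exists_poleDivisor (z : F) : ∃ D : Divisor K F, ⇑D = poleDivisor z := by
  refine ⟨Finsupp.ofSupportFinite (poleDivisor z) ((finite_poles z).subset fun P hP => ?_), rfl⟩
  by_contra h
  rw [Set.mem_ofPred_eq, not_lt, ← P.poleOrder_eq_zero_iff] at h
  exact hP (by simp [poleDivisor, h])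

theorem exists_effective_of_finite {ι : Type*} [Fintype ι] (u : ι → F) :
    ∃ C : Divisor K F, 0 ≤ C ∧ ∀ i, u i ∈ riemannRochSpace C := by
  choose D hD using fun i => exists_poleDivisor (K := K) (u i)
  have h0 : ∀ i, 0 ≤ D i := fun i P => by
    have : D i P = _ := congr_fun (hD i) P
    rw [this]; exact Int.natCast_nonneg _
  refine ⟨∑ i, D i, Finset.sum_nonneg fun i _ => h0 i, fun i => ?_⟩
  refine riemannRochSpace_mono (Finset.single_le_sum (fun i _ => h0 i) (Finset.mem_univ i)) ?_
  rw [mem_riemannRochSpace_iff]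
  intro P
  have : D i P = _ := congr_fun (hD i) P
  rw [this]
  exact P.valuation_le_exp_poleOrder _

/-- A nonzero function in `L(D)` has at most `deg D` zeros. -/
theorem card_zeros_le_degree {Q : Place K F} (hQ : Q.IsRational) {D : Divisor K F}
    (hD : 0 ≤ D) {h : F} (h0 : h ≠ 0) (hmem : h ∈ riemannRochSpace D) (S : Finset (Place K F))
    (hS : ∀ P ∈ S, P.valuation h < 1) : (S.card : ℤ) ≤ degree D := by
  obtain ⟨u, hu, hind⟩ := exists_independent_on S
  obtain ⟨C, hC, huC⟩ := exists_effective_of_finite (K := K) u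
  have key : ∀ k : ℕ, ((k : ℤ) + 1) * S.card ≤ k * degree D + degree C + 1 := by
    intro k
    let E : Divisor K F := k • D + C
    have hE : 0 ≤ E := add_nonneg (nsmul_nonneg hD k) hC
    obtain ⟨hfin, hrank⟩ := finrank_riemannRochSpace_le hQ hE
    have hm : ∀ ai : Fin (k + 1) × S, h ^ (ai.1 : ℕ) * u ai.2 ∈ riemannRochSpace E := by
      intro ai
      refine riemannRochSpace_mono ?_
        (mul_mem_riemannRochSpace (pow_mem_riemannRochSpace hmem ai.1) (huC ai.2))
      exact add_le_add_left (nsmul_le_nsmul_left hD (by omega)) _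
    let w : Fin (k + 1) × S → riemannRochSpace E := fun ai => ⟨_, hm ai⟩
    have hw : LinearIndependent K w := by
      rw [Fintype.linearIndependent_iff]
      intro c hc
      have hc' : ∑ ai : Fin (k + 1) × S, c ai • (h ^ (ai.1 : ℕ) * u ai.2) = 0 := by
        have := congrArg (riemannRochSpace E).subtype hc
        simpa [w] using this
      have hp := eq_zero_of_sum_aeval_mul_eq_zero_of_places (S : Set (Place K F)) h0 hS
        (fun P h i => hu ⟨P, h⟩ i) (fun c hc => hind c fun P => hc P.1 P.2)
        -- A relation over `K` among the `h ^ a * u i` is a relation over `K[h]` among the `u i`.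
        (fun i => ∑ a : Fin (k + 1), Polynomial.C (c (a, i)) * X ^ (a : ℕ)) (by
          rw [← hc', Fintype.sum_prod_type_right]
          refine Finset.sum_congr rfl fun i _ => ?_
          simp [Finset.sum_mul, Algebra.smul_def, mul_assoc])
      rintro ⟨a, i⟩
      have := congrArg (fun p => coeff p (a : ℕ)) (congr_fun hp i)
      simpa [finsetSum_coeff, coeff_C_mul, coeff_X_pow, Fin.val_inj] using this
    have hcard := hw.fintype_card_le_finrank
    rw [Fintype.card_prod, Fintype.card_fin, Fintype.card_coe] at hcard
    have hcard' : ((k : ℤ) + 1) * S.card ≤ Module.finrank K (riemannRochSpace E) := by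
      exact_mod_cast hcard
    have hdeg : degree E = k * degree D + degree C := by
      rw [degree_add, degree_nsmul]
    linarith
  by_contra! hlt
  have hC0 := degree_nonneg hC
  have hD0 := degree_nonneg hD
  -- If `|S| ≥ deg D + 1`, the inequality forces `deg D + k ≤ deg C`, which fails for `k = deg C +
  -- 1`.
  have := key (degree C).toNat.succ
  push_cast [Int.toNat_of_nonneg hC0] at this
  nlinarith

end Divisors

end AGCode

namespace AGCode

/-! ### Pole orders of the products, responses and decoding. -/

section Codes

variable {K F : Type*} [Field K] [Field F] [Algebra K F]

namespace Place

theorem ord_eq_of_poleOrder_pos (P : Place K F) {z : F} {k : ℕ} (hk : 0 < k)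
    (h : P.poleOrder z = k) : P.ord z = -k := by
  rw [poleOrder] at h
  omega

theorem ne_zero_of_ord_ne_zero (P : Place K F) {z : F} (h : P.ord z ≠ 0) : z ≠ 0 := by
  rintro rfl
  simp [ord] at h

theorem IsRational.exists_valuation_sub_lt_one {P : Place K F} (hP : P.IsRational) {z : F}
    (hz : P.valuation z ≤ 1) : ∃ c : K, P.valuation (z - algebraMap K F c) < 1 := by
  have hbij := Module.Free.bijective_algebraMap_of_finrank_eq_one hP
  rw [P.valuation_le_one_iff] at hz
  obtain ⟨c, hc⟩ := hbij.2 (IsLocalRing.residue P.ring ⟨z, hz⟩)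
  refine ⟨c, ?_⟩
  have h : IsLocalRing.residue P.ring (⟨z, hz⟩ - algebraMap K P.ring c) = 0 := by
    rw [map_sub, ← hc, sub_eq_zero]
    rfl
  rw [P.residue_eq_zero_iff] at h
  exact h

theorem IsRational.valuation_sub_eval_lt_one {P : Place K F} (hP : P.IsRational) {z : F}
    (hz : P.valuation z ≤ 1) : P.valuation (z - algebraMap K F (P.eval z)) < 1 := by
  have h := hP.exists_valuation_sub_lt_one hz
  rw [eval, dif_pos h]
  exact h.choose_spec

theorem poleOrder_pow_mul_pow (P : Place K F) {x y : F} (hx : x ≠ 0) (hy : y ≠ 0) (i j : ℕ) :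
    P.poleOrder (x ^ i * y ^ j) = (-(i * P.ord x + j * P.ord y)).toNat := by
  rw [poleOrder, P.ord_mul (pow_ne_zero _ hx) (pow_ne_zero _ hy), ord_pow, ord_pow]

/-- The order is linear in `(i, j)`, so each factor is optimized separately: maximal exponent where
the function has a pole, exponent 0 where it has a zero. -/
theorem sup_poleOrder_pow_mul_pow (P : Place K F) {x y : F} (hx : x ≠ 0) (hy : y ≠ 0) {m n : ℕ}
    (hm : 0 < m) (hn : 0 < n) :
    (Finset.univ.sup fun ij : Fin m × Fin n => P.poleOrder (x ^ (ij.1 : ℕ) * y ^ (ij.2 : ℕ))) =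
      (m - 1) * P.poleOrder x + (n - 1) * P.poleOrder y := by
  have hterm : ∀ (o : ℤ) (i k : ℕ), i ≤ k → -(i * o) ≤ k * ((-o).toNat : ℤ) := by
    intro o i k hik
    have h1 : -o ≤ ((-o).toNat : ℤ) := Int.self_le_toNat _
    have h2 : (0 : ℤ) ≤ ((-o).toNat : ℤ) := Int.natCast_nonneg _
    calc -(i * o) = i * (-o) := by ring
      _ ≤ i * ((-o).toNat : ℤ) := mul_le_mul_of_nonneg_left h1 (Int.natCast_nonneg _)
      _ ≤ k * ((-o).toNat : ℤ) := mul_le_mul_of_nonneg_right (by exact_mod_cast hik) h2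
  have hattain : ∀ (o : ℤ) (k : ℕ), ∃ i ≤ k, -(i * o) = k * ((-o).toNat : ℤ) := by
    intro o k
    rcases le_or_gt o 0 with h | h
    · refine ⟨k, le_rfl, ?_⟩
      rw [Int.toNat_of_nonneg (by omega)]
      ring
    · refine ⟨0, Nat.zero_le _, ?_⟩
      rw [Int.toNat_eq_zero.2 (by omega)]
      simp
  refine le_antisymm (Finset.sup_le fun ij _ => ?_) ?_
  · rw [P.poleOrder_pow_mul_pow hx hy, Int.toNat_le]
    have h1 := hterm (P.ord x) ij.1 (m - 1) (by omega)
    have h2 := hterm (P.ord y) ij.2 (n - 1) (by omega)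
    rw [poleOrder, poleOrder]
    push_cast
    linarith
  · obtain ⟨i, hi, hi'⟩ := hattain (P.ord x) (m - 1)
    obtain ⟨j, hj, hj'⟩ := hattain (P.ord y) (n - 1)
    refine le_trans ?_ (Finset.le_sup (Finset.mem_univ
      ((⟨i, by omega⟩, ⟨j, by omega⟩) : Fin m × Fin n)))
    rw [P.poleOrder_pow_mul_pow hx hy, poleOrder, poleOrder]
    zify
    refine le_trans (le_of_eq ?_) (Int.self_le_toNat _)
    linarith

theorem valuation_sum_sub_lt_one {ι : Type*} (P : Place K F) (s : Finset ι) {x y : ι → F}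
    (h : ∀ i ∈ s, P.valuation (x i - y i) < 1) :
    P.valuation (∑ i ∈ s, x i - ∑ i ∈ s, y i) < 1 := by
  rw [← Finset.sum_sub_distrib]
  exact P.valuation.map_sum_lt one_ne_zero h

end Place

variable {m n r s t : ℕ} {f : Fin m → F} {g : Fin n → F}

theorem poleOrder_le_productPoleDivisor (P : Place K F) (f : Fin m → F) (g : Fin n → F)
    (i : Fin m) (j : Fin n) : (P.poleOrder (f i * g j) : ℤ) ≤ productPoleDivisor f g P := by
  have h := Finset.le_sup (f := fun ij : Fin m × Fin n => P.poleOrder (f ij.1 * g ij.2))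
    (Finset.mem_univ (i, j))
  exact Int.ofNat_le.2 h

theorem mul_mem_of_eq_productPoleDivisor {D : Divisor K F} (hD : ⇑D = productPoleDivisor f g)
    (i : Fin m) (j : Fin n) : f i * g j ∈ riemannRochSpace D := by
  rw [mem_riemannRochSpace_iff]
  intro P
  refine (P.valuation_le_exp_poleOrder _).trans ?_
  rw [WithZero.exp_le_exp, hD]
  exact poleOrder_le_productPoleDivisor P f g i j

theorem leftPoly_apply (f : Fin m → F) (A : Matrix (Fin m × Fin r) (Fin s) K) (a : Fin r)
    (k : Fin s) : leftPoly f A a k = ∑ i, A (i, a) k • f i := by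
  simp [leftPoly, Matrix.sum_apply, Algebra.smul_def, mul_comm]

theorem rightPoly_apply (g : Fin n → F) (B : Matrix (Fin s) (Fin n × Fin t) K) (k : Fin s)
    (b : Fin t) : rightPoly g B k b = ∑ j, B k (j, b) • g j := by
  simp [rightPoly, Matrix.sum_apply, Algebra.smul_def, mul_comm]

theorem leftPoly_mul_rightPoly_apply (f : Fin m → F) (g : Fin n → F)
    (A : Matrix (Fin m × Fin r) (Fin s) K) (B : Matrix (Fin s) (Fin n × Fin t) K) (a : Fin r)
    (b : Fin t) : (leftPoly f A * rightPoly g B) a b =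
      ∑ ij : Fin m × Fin n, (A * B) (ij.1, a) (ij.2, b) • (f ij.1 * g ij.2) := by
  simp only [Matrix.mul_apply, leftPoly_apply, rightPoly_apply, Finset.sum_mul_sum,
    Finset.sum_smul, Fintype.sum_prod_type]
  rw [Finset.sum_comm]
  refine Finset.sum_congr rfl fun i _ => ?_
  rw [Finset.sum_comm]
  simp only [smul_mul_smul_comm]

theorem leftPoly_mul_rightPoly_mem {D : Divisor K F} (hD : ⇑D = productPoleDivisor f g)
    (A : Matrix (Fin m × Fin r) (Fin s) K) (B : Matrix (Fin s) (Fin n × Fin t) K) (a : Fin r)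
    (b : Fin t) : (leftPoly f A * rightPoly g B) a b ∈ riemannRochSpace D := by
  rw [leftPoly_mul_rightPoly_apply]
  exact Submodule.sum_mem _ fun ij _ =>
    Submodule.smul_mem _ _ (mul_mem_of_eq_productPoleDivisor hD _ _)

/-- The least common multiple of the pole divisors of the `f_i g_j` is the least effective divisor
whose Riemann-Roch space contains all the entries of the products. -/
theorem isLeast_productPoleDivisor {D : Divisor K F} (hD : ⇑D = productPoleDivisor f g)
    (h0 : ∀ i j, f i * g j ≠ 0) (hr : 0 < r) (hs : 0 < s) (ht : 0 < t) :
    IsLeast {E : Divisor K F | 0 ≤ E ∧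
      ∀ (A : Matrix (Fin m × Fin r) (Fin s) K) (B : Matrix (Fin s) (Fin n × Fin t) K)
        (a : Fin r) (b : Fin t), (leftPoly f A * rightPoly g B) a b ∈ riemannRochSpace E} D := by
  refine ⟨⟨fun P => ?_, fun A B a b => leftPoly_mul_rightPoly_mem hD A B a b⟩, ?_⟩
  · rw [hD]
    exact Int.natCast_nonneg _
  · rintro E ⟨hE0, hE⟩ P
    obtain ⟨k, hk⟩ := Int.eq_ofNat_of_zero_le (hE0 P)
    rw [hD, hk, productPoleDivisor, Nat.cast_le]
    refine Finset.sup_le fun ⟨i, j⟩ _ => ?_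
    -- Matrix units for the data isolate the single product `f i * g j` as an entry of `h`.
    have hmem := hE (Matrix.single (i, ⟨0, hr⟩) ⟨0, hs⟩ 1) (Matrix.single ⟨0, hs⟩ (j, ⟨0, ht⟩) 1)
      ⟨0, hr⟩ ⟨0, ht⟩
    rw [leftPoly_mul_rightPoly_apply, Matrix.single_mul_single_same,
      Finset.sum_eq_single (i, j)] at hmem
    · simp only [Matrix.single_apply_same, mul_one, one_smul] at hmem
      have := hmem (h0 i j) P
      rw [Place.poleOrder, Int.toNat_le]
      linarith
    · rintro ⟨i', j'⟩ _ hne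
      rw [Matrix.single_apply_of_ne, zero_smul]
      rintro ⟨h1, h2⟩
      exact hne (by simp_all)
    · simp

/-- A nontrivial combination has the value of one of the `u i`. Non-vanishing is assumed separately,
as the dummy value `ord 0 = 0` does not detect it. -/
theorem linearIndependent_of_ord_ne (Q : Place K F) {ι : Type*} [Fintype ι] {u : ι → F}
    (h0 : ∀ i, u i ≠ 0) (hu : Function.Injective fun i => Q.ord (u i)) :
    LinearIndependent K u := by
  rw [Fintype.linearIndependent_iff]
  intro c hc
  by_contra! hne
  have hinj : Function.Injective fun i => Q.valuation (u i) := fun i i' h => hu (by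
    have h : Q.valuation (u i) = Q.valuation (u i') := h
    simp only [Place.ord, h])
  obtain ⟨i, hi⟩ := exists_valuation_sum_smul_eq Q.valuation Q.valuation_algebraMap hinj
    (Function.ne_iff.2 hne)
  rw [hc, map_zero, eq_comm, Valuation.zero_iff] at hi
  exact h0 i hi

/-- At a rational place off the poles, the response of the worker is the value of the product. -/
theorem valuation_sub_response_lt_one {P : Place K F} (hP : P.IsRational)
    (hf : ∀ i, P.valuation (f i) ≤ 1) (hg : ∀ j, P.valuation (g j) ≤ 1)
    (A : Matrix (Fin m × Fin r) (Fin s) K) (B : Matrix (Fin s) (Fin n × Fin t) K) (a : Fin r)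
    (b : Fin t) : P.valuation ((leftPoly f A * rightPoly g B) a b -
      algebraMap K F (response f g A B P a b)) < 1 := by
  have hreg : ∀ {k : ℕ} (c : Fin k → K) (u : Fin k → F), (∀ i, P.valuation (u i) ≤ 1) →
      P.valuation (∑ i, c i • u i) ≤ 1 := by
    intro k c u hu
    refine P.valuation.map_sum_le fun i _ => ?_
    rw [Algebra.smul_def, map_mul]
    exact mul_le_one' (P.valuation_algebraMap _) (hu i)
  rw [response, Matrix.mul_apply, Matrix.mul_apply, map_sum]
  refine P.valuation_sum_sub_lt_one _ fun k _ => ?_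
  rw [Matrix.map_apply, Matrix.map_apply, map_mul]
  have hx : P.valuation (leftPoly f A a k) ≤ 1 := by
    rw [leftPoly_apply]; exact hreg _ _ hf
  have hy : P.valuation (rightPoly g B k b) ≤ 1 := by
    rw [rightPoly_apply]; exact hreg _ _ hg
  have hx' := hP.valuation_sub_eval_lt_one hx
  have hy' := hP.valuation_sub_eval_lt_one hy
  generalize leftPoly f A a k = x at *
  generalize rightPoly g B k b = y at *
  have : x * y - algebraMap K F (P.eval x) * algebraMap K F (P.eval y) =
      x * (y - algebraMap K F (P.eval y)) + algebraMap K F (P.eval y) *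
        (x - algebraMap K F (P.eval x)) := by ring
  rw [this]
  refine P.valuation.map_add_lt ?_ ?_
  · rw [map_mul]
    exact (mul_le_of_le_one_left' hx).trans_lt hy'
  · rw [map_mul]
    exact (mul_le_of_le_one_left' (P.valuation_algebraMap _)).trans_lt hx'

/-- More than `deg (h)_∞` responses determine the product of the data matrices. -/
theorem exists_decode [Algebra (RatFunc K) F] [IsScalarTower K (RatFunc K) F] [FunctionField K F]
    {Q : Place K F} (hQ : Q.IsRational) {D : Divisor K F} (hD : ⇑D = productPoleDivisor f g)
    (hli : LinearIndependent K fun ij : Fin m × Fin n => f ij.1 * g ij.2)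
    (S : Finset (Place K F))
    (hS : ∀ P ∈ S, P.IsRational ∧ (∀ i, P.valuation (f i) ≤ 1) ∧ ∀ j, P.valuation (g j) ≤ 1)
    (hcard : degree D < S.card) (r s t : ℕ) :
    ∃ decode : (S → Matrix (Fin r) (Fin t) K) → Matrix (Fin m × Fin r) (Fin n × Fin t) K,
      ∀ (A : Matrix (Fin m × Fin r) (Fin s) K) (B : Matrix (Fin s) (Fin n × Fin t) K),
        decode (fun P => response f g A B P.1) = A * B := by
  let encode : Matrix (Fin m × Fin r) (Fin s) K × Matrix (Fin s) (Fin n × Fin t) K →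
    S → Matrix (Fin r) (Fin t) K := fun AB P => response f g AB.1 AB.2 P.1
  have hfac : Function.FactorsThrough (fun AB : Matrix (Fin m × Fin r) (Fin s) K ×
      Matrix (Fin s) (Fin n × Fin t) K => AB.1 * AB.2) encode := by
    rintro ⟨A, B⟩ ⟨A', B'⟩ heq
    have hresp : ∀ P ∈ S, response f g A B P = response f g A' B' P :=
      fun P hP => congr_fun heq ⟨P, hP⟩
    ext ⟨i, a⟩ ⟨j, b⟩
    set h := (leftPoly f A * rightPoly g B) a b - (leftPoly f A' * rightPoly g B') a b with hh
    have hmem : h ∈ riemannRochSpace D := Submodule.sub_mem _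
      (leftPoly_mul_rightPoly_mem hD A B a b) (leftPoly_mul_rightPoly_mem hD A' B' a b)
    have h0 : h = 0 := by
      by_contra hne
      refine absurd (card_zeros_le_degree hQ (fun P => ?_) hne hmem S fun P hP => ?_)
        (not_le.2 hcard)
      · rw [hD]
        exact Int.natCast_nonneg _
      · obtain ⟨h1, h2, h3⟩ := hS P hP
        have e1 := valuation_sub_response_lt_one h1 h2 h3 A B a b
        have e2 := valuation_sub_response_lt_one h1 h2 h3 A' B' a b
        rw [hresp P hP] at e1
        rw [hh, ← sub_sub_sub_cancel_right _ _ (algebraMap K F (response f g A' B' P a b))]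
        exact P.valuation.map_sub_lt e1 e2
    rw [hh, leftPoly_mul_rightPoly_apply, leftPoly_mul_rightPoly_apply,
      ← Finset.sum_sub_distrib] at h0
    simp only [← sub_smul] at h0
    exact sub_eq_zero.1 (Fintype.linearIndependent_iff.1 hli _ h0 (i, j))
  -- `AB` is a function of the responses; on tuples that are not responses the decoder takes the
  -- arbitrary value 0.
  exact ⟨Function.extend encode (fun AB => AB.1 * AB.2) 0, fun A B => hfac.extend_apply 0 (A, B)⟩

end Codes

end AGCode

/-! ### The code of a friendly function field. -/

theorem mainTheorem5 {K F : Type*} [Field K] [Finite K] [Field F] [Algebra K F]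
    [Algebra (RatFunc K) F] [IsScalarTower K (RatFunc K) F] [FunctionField K F]
    (m n : ℕ) (Q : AGCode.Place K F) (z₁ z₂ : F) (hfr : AGCode.IsFriendly m n Q z₁ z₂)
    (f : Fin m → F) (hf : ∀ i, f i = z₁ ^ (i : ℕ))
    (g : Fin n → F) (hg : ∀ j, g j = z₂ ^ (j : ℕ)) :
    -- the valuations of the products, in terms of the sign `v_Q(z₁) = ±1`
    (∀ i j, Q.ord (f i * g j) = Q.ord z₁ * (i : ℤ) - (m : ℤ) * (j : ℤ)) ∧
    -- if `z₁` has a simple pole, the pole orders (indices starting at 0) are `i + m j`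
    (Q.ord z₁ = -1 → ∀ i j, -Q.ord (f i * g j) = (i : ℤ) + (m : ℤ) * (j : ℤ)) ∧
    -- they are pairwise distinct, and `f`, `g` form a polynomial AG code
    AGCode.IsPolynomialAGCode Q f g ∧
    LinearIndependent K (fun ij : Fin m × Fin n => f ij.1 * g ij.2) ∧
    -- the recovery threshold `deg (h)_∞ + 1`
    AGCode.recoveryThreshold K f g = AGCode.genus K F + (m : ℤ) * (n : ℤ) ∧
    -- `(h)_∞` is the least effective divisor `D` such that all entries of `h` are in `L(D)`,
    -- whatever the data matrices are
    (∃ D : AGCode.Divisor K F, ⇑D = AGCode.productPoleDivisor f g ∧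
      ∀ r s t : ℕ, 0 < r → 0 < s → 0 < t →
        IsLeast {E : AGCode.Divisor K F | 0 ≤ E ∧
          ∀ (A : Matrix (Fin m × Fin r) (Fin s) K) (B : Matrix (Fin s) (Fin n × Fin t) K)
            (a : Fin r) (b : Fin t),
            (AGCode.leftPoly f A * AGCode.rightPoly g B) a b ∈ AGCode.riemannRochSpace E} D) ∧
    -- the responses of any `g(F) + mn` worker nodes suffice to recover `A * B`
    (∀ r s t : ℕ, ∀ S : Finset (AGCode.Place K F),
      (∀ P ∈ S, P.IsRational ∧ AGCode.productPoleDivisor f g P = 0) →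
      AGCode.genus K F + (m : ℤ) * (n : ℤ) ≤ (S.card : ℤ) →
      ∃ decode : (S → Matrix (Fin r) (Fin t) K) → Matrix (Fin m × Fin r) (Fin n × Fin t) K,
        ∀ (A : Matrix (Fin m × Fin r) (Fin s) K) (B : Matrix (Fin s) (Fin n × Fin t) K),
          decode (fun P => AGCode.response f g A B P.1) = A * B) := by
  open AGCode in
  have hm := hfr.two_le
  have hn := hfr.one_le
  have hz₁ : z₁ ≠ 0 := Q.ne_zero_of_ord_ne_zero (by have := hfr.ord_z₁; omega)
  have hpole : ∀ P : Place K F, (P.poleOrder z₂ : ℤ) = Finsupp.single Q (m : ℤ) P :=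
    fun P => congr_fun hfr.poleDivisor_z₂ P
  have hord₂ : Q.ord z₂ = -m := by
    have := hpole Q
    rw [Finsupp.single_eq_same, Nat.cast_inj] at this
    exact Q.ord_eq_of_poleOrder_pos (by omega) this
  have hz₂ : z₂ ≠ 0 := Q.ne_zero_of_ord_ne_zero (by omega)
  have hne : ∀ i j, f i * g j ≠ 0 := fun i j => by
    rw [hf, hg]
    exact mul_ne_zero (pow_ne_zero _ hz₁) (pow_ne_zero _ hz₂)
  have hord : ∀ i j, Q.ord (f i * g j) = Q.ord z₁ * (i : ℤ) - (m : ℤ) * (j : ℤ) := by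
    intro i j
    rw [hf, hg, Q.ord_mul (pow_ne_zero _ hz₁) (pow_ne_zero _ hz₂), Q.ord_pow, Q.ord_pow, hord₂]
    ring
  have hinj : Function.Injective fun ij : Fin m × Fin n => Q.ord (f ij.1 * g ij.2) := by
    rintro ⟨i, j⟩ ⟨i', j'⟩ h
    simp only [hord] at h
    -- Whichever sign `v_Q(z₁)` has, equal orders force `i ≡ i'` modulo `m`, and both indices are
    -- below `m`.
    have hdvd : (m : ℤ) ∣ (i : ℤ) - i' := by
      rcases hfr.ord_z₁ with he | he <;> rw [he] at h
      · exact ⟨j - j', by linarith⟩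
      · exact ⟨j' - j, by linarith⟩
    have hi : (i : ℤ) - i' = 0 := by
      refine Int.eq_zero_of_abs_lt_dvd hdvd ?_
      rw [abs_lt]
      constructor <;> omega
    have hi' : (i : ℤ) = i' := by omega
    have hj : (m : ℤ) * j = m * j' := by rw [hi'] at h; linarith
    have hj' : (j : ℤ) = j' := mul_left_cancel₀ (by omega) hj
    exact Prod.ext (Fin.ext (by exact_mod_cast hi')) (Fin.ext (by exact_mod_cast hj'))
  have hli : LinearIndependent K (fun ij : Fin m × Fin n => f ij.1 * g ij.2) :=
    linearIndependent_of_ord_ne Q (fun ij => hne _ _) hinj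
  -- As both families contain 1, independence and regularity of each family follow from those of the
  -- products.
  have hf0 : f ⟨0, by omega⟩ = 1 := by rw [hf, pow_zero]
  have hg0 : g ⟨0, by omega⟩ = 1 := by rw [hg, pow_zero]
  obtain ⟨D₁, hD₁⟩ := exists_poleDivisor (K := K) z₁
  obtain ⟨D, hD⟩ : ∃ D : Divisor K F, D = (m - 1) • D₁ + (n - 1) • Finsupp.single Q (m : ℤ) :=
    ⟨_, rfl⟩
  have hDprod : ⇑D = productPoleDivisor f g := by
    funext P
    have h1 : D₁ P = P.poleOrder z₁ := congr_fun hD₁ P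
    simp only [productPoleDivisor, hf, hg]
    rw [P.sup_poleOrder_pow_mul_pow hz₁ hz₂ (by omega) (by omega), hD, Finsupp.add_apply,
      Finsupp.smul_apply, Finsupp.smul_apply, ← hpole, h1]
    simp
  have hdeg : degree D = genus K F + m * n - 1 := by
    obtain ⟨k, hk⟩ := hfr.dvd_genus
    have hd := hfr.degree_z₁
    have hQ : Q.degree = 1 := hfr.isRational
    -- Divisibility makes the integer quotient `genus / (m - 1)` exact; `m ≥ 2` keeps the divisor
    -- nonzero.
    rw [hk, Int.mul_ediv_cancel_left _ (by omega), ← hD₁] at hd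
    rw [hD, degree_add, degree_nsmul, degree_nsmul, degree_single, hd, hQ, hk]
    push_cast [Nat.cast_sub (by omega : 1 ≤ m), Nat.cast_sub hn]
    ring
  refine ⟨hord, fun he i j => ?_, ⟨?_, ?_, ?_, ?_⟩, hli, ?_, ⟨D, hDprod, fun r s t hr hs ht =>
    isLeast_productPoleDivisor hDprod hne hr hs ht⟩, fun r s t S hS hcard => ?_⟩
  · rw [hord, he]
    ring
  · obtain ⟨G, -, hG⟩ := exists_effective_of_finite (K := K) ![z₁, z₂]
    refine ⟨G, fun i => ⟨i, ?_⟩, fun j => ⟨j, ?_⟩⟩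
    · rw [hf]
      exact pow_mem_riemannRochSpace (hG 0) _
    · rw [hg]
      exact pow_mem_riemannRochSpace (hG 1) _
  · simpa [Function.comp_def, hg0] using
      hli.comp (fun i => (i, (⟨0, by omega⟩ : Fin n))) fun i i' h => (Prod.ext_iff.1 h).1
  · simpa [Function.comp_def, hf0] using
      hli.comp (fun j => ((⟨0, by omega⟩ : Fin m), j)) fun j j' h => (Prod.ext_iff.1 h).2
  · exact fun i i' j j' hne' h => hne' (@hinj (i, j) (i', j') h)
  · rw [recoveryThreshold, ← hDprod, hdeg]
    ring
  · refine exists_decode hfr.isRational hDprod hli S (fun P hP => ?_) (by rw [hdeg]; omega) r s t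
    obtain ⟨hrat, hP0⟩ := hS P hP
    have hreg : ∀ i j, P.valuation (f i * g j) ≤ 1 := fun i j => by
      rw [← P.poleOrder_eq_zero_iff]
      have := poleOrder_le_productPoleDivisor P f g i j
      rw [hP0] at this
      exact Nat.le_zero.1 (Int.ofNat_le.1 this)
    refine ⟨hrat, fun i => ?_, fun j => ?_⟩
    · simpa [hg0] using hreg i ⟨0, by omega⟩
    · simpa [hf0] using hreg ⟨0, by omega⟩ j
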